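/- Let $M^2$ be a complete connected Riemannian surface (without boundary) with metric $g_M$ and distance $\mathrm{dist}$, and let $M\times\mathbb{R}$ carry the Lorentzian metric $g_M-dt^2$. Let $\Omega\subseteq M$ be a closed domain (possibly with boundary, possibly $\Omega=M$; in fact any closed subset is allowed) that is starlike with respect to a point $x_0\in\mathrm{int}(\Omega)$, i.e. for every $x\in\Omega$ there is a minimizing geodesic segment from $x_0$ to $x$ contained in $\Omega$. Let $u$ be a smooth real function on $\Omega$ (up to its boundary points) whose graph $\Sigma(u)=\{(x,u(x)) : x\in\Omega\}\subset M\times\mathbb{R}$ is spacelike, i.e. $g_M-du^2$ is positive definite at every point of $\Omega$ (at boundary points $du$ is a differential of $u$ relative to $\Omega$). For $(x,t)\in\Sigma(u)$ put $r(x,t)=\mathrm{dist}(x,x_0)$ and let $h(x,t)=t-u(x_0)$ be the height measured from the point of $\Sigma(u)$ over $x_0$ (so $h=t$ when the graph is normalized, by a vertical translation, so that $u(x_0)=0$). Then the function $\phi=r^2-h^2$ is eventually positive on $\Sigma(u)$ (it is positive outside some compact subset of $\Sigma(u)$), and $\phi:\Sigma(u)\to\mathbb{R}$ is proper. -/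

import Mathlib

open Set Filter Topology Bundle
open scoped Manifold ContDiff

noncomputable section GraphDefs

variable {M : Type*} [MetricSpace M] [ChartedSpace (EuclideanSpace ℝ (Fin 2)) M]

/-- The graph `Σ(u)` of `u` over `Ω`, as a subset of `M × ℝ`. Only the values of `u` on `Ω` matter. -/
def graphSurface (Ω : Set M) (u : M → ℝ) : Set (M × ℝ) :=
  {p | p.1 ∈ Ω ∧ p.2 = u p.1}

/-- The function `r² - (h - t₀)²` on `M × ℝ`, where `r` is the distance on `M` to `x₀` and `h` is
the height. -/
def lorentzPhi (x₀ : M) (t₀ : ℝ) (p : M × ℝ) : ℝ :=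
  dist p.1 x₀ ^ 2 - (p.2 - t₀) ^ 2

variable [RiemannianBundle (fun x : M => TangentSpace (𝓡 2) x)]

/-- The quadratic form of the Lorentzian metric `g_M - dt²` on `T_x M × ℝ = T_(x,t) (M × ℝ)`. -/
def lorentzForm (x : M) (v : TangentSpace (𝓡 2) x) (τ : ℝ) : ℝ :=
  inner ℝ v v - τ ^ 2

/-- `Σ(u)` is a spacelike graph over `Ω`: `u` is smooth on `Ω` (up to the points of `Ω` that lie on
its boundary), and at each point the metric `g_M - du²` induced by the embedding `x ↦ (x, u x)` is
positive definite. The differential `du` is the one relative to `Ω`; it is unique, for example, at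
interior points and at boundary points where the boundary is smooth. -/
structure IsSpacelikeGraph (Ω : Set M) (u : M → ℝ) : Prop where
  smooth : ContMDiffOn (𝓡 2) 𝓘(ℝ, ℝ) ∞ u Ω
  spacelike : ∀ x ∈ Ω, ∃ du : TangentSpace (𝓡 2) x →L[ℝ] ℝ,
    HasMFDerivWithinAt (𝓡 2) 𝓘(ℝ, ℝ) u Ω x du ∧
      ∀ v : TangentSpace (𝓡 2) x, v ≠ 0 → 0 < lorentzForm x v (du v)

/-- `γ`, restricted to `[0, dist x y]`, is a minimizing geodesic segment from `x` to `y`: a smooth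
curve from `x` to `y` parametrized by arc length, whose length is the distance of its end points.
(The unit speed condition at the end points follows by continuity.) -/
structure IsMinimizingGeodesic (γ : ℝ → M) (x y : M) : Prop where
  source : γ 0 = x
  target : γ (dist x y) = y
  smooth : ContMDiffOn 𝓘(ℝ, ℝ) (𝓡 2) ∞ γ (Icc 0 (dist x y))
  unit_speed : ∀ s ∈ Ioo 0 (dist x y), ‖mfderiv 𝓘(ℝ, ℝ) (𝓡 2) γ s 1‖ = 1

/-- `Ω` is starlike with respect to its interior point `x₀`. -/
structure IsStarlike (Ω : Set M) (x₀ : M) : Prop where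
  mem_interior : x₀ ∈ interior Ω
  exists_geodesic : ∀ x ∈ Ω, ∃ γ : ℝ → M, IsMinimizingGeodesic γ x₀ x ∧
    ∀ s ∈ Icc 0 (dist x₀ x), γ s ∈ Ω

end GraphDefs

/-! Let `γ` be a unit speed minimizing geodesic from `x₀` inside `Ω`. Spacelikeness gives `|(u ∘
γ)'| < 1`, so `r - h` and `r + h` increase along `γ`, and hence so does their minimum `r - |h|`. By
a Hopf–Rinow argument within `Ω`, the set `Ω ∩ {r = 1}` is compact. There `r - |h|` is bounded below
by some `η > 0`, and monotonicity carries this bound to all of `r ≥ 1`. Consequently `φ = (r -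
|h|)(r + |h|) ≥ η r` where `r ≥ 1`, so `φ ≤ c` confines `r` to a bounded range and the sublevel sets
of `φ` are compact. Both claims follow. -/

/-- A continuous-induction form of the Hopf–Rinow theorem: if `s` is a closed subset of a complete,
locally compact metric space, and every point of `s` can be joined to `x₀` inside `s` by points
realizing the distance, then the bounded parts of `s` are compact. -/
theorem isCompact_inter_closedBall_of_segments {X : Type*} [MetricSpace X] [CompleteSpace X]
    [LocallyCompactSpace X] {s : Set X} (hs : IsClosed s) {x₀ : X}
    (hseg : ∀ y ∈ s, ∀ r ∈ Icc 0 (dist x₀ y),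
      ∃ z ∈ s, dist x₀ z ≤ r ∧ dist z y ≤ dist x₀ y - r) (R : ℝ) :
    IsCompact (s ∩ Metric.closedBall x₀ R) := by
  have hcl : ∀ r, IsClosed (s ∩ Metric.closedBall x₀ r) :=
    fun r => hs.inter Metric.isClosed_closedBall
  have hstep : ∀ r ρ, 0 ≤ r → r ≤ ρ → ∀ y ∈ s ∩ Metric.closedBall x₀ ρ,
      ∃ z ∈ s ∩ Metric.closedBall x₀ r, dist y z ≤ ρ - r := by
    rintro r ρ hr hrρ y ⟨hys, hy⟩
    rw [Metric.mem_closedBall, dist_comm] at hy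
    rcases le_total (dist x₀ y) r with h | h
    · exact ⟨y, ⟨hys, by rwa [Metric.mem_closedBall, dist_comm]⟩, by simpa using hrρ⟩
    · obtain ⟨z, hzs, hz, hzy⟩ := hseg y hys r ⟨hr, h⟩
      refine ⟨z, ⟨hzs, by rwa [Metric.mem_closedBall, dist_comm]⟩, ?_⟩
      rw [dist_comm]
      linarith
  rcases lt_or_ge R 0 with hR | hR
  · simp [Metric.closedBall_eq_empty.2 hR]
  let S : Set ℝ := {r | IsCompact (s ∩ Metric.closedBall x₀ r)}
  have hdown : ∀ r ∈ S, ∀ ρ ≤ r, ρ ∈ S := fun r hr ρ hρ =>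
    IsCompact.of_isClosed_subset hr (hcl ρ)
      (inter_subset_inter_right _ (Metric.closedBall_subset_closedBall hρ))
  have h0 : (0 : ℝ) ∈ S := by
    refine isCompact_singleton (x := x₀) |>.of_isClosed_subset (hcl 0) ?_
    simp
  have hclosed : IsClosed (S ∩ Icc 0 R) := by
    refine isClosed_of_closure_subset fun ρ hρ => ?_
    have hρI : ρ ∈ Icc 0 R :=
      closure_minimal inter_subset_right isClosed_Icc hρ
    refine ⟨?_, hρI⟩
    refine isCompact_iff_totallyBounded_isComplete.2
      ⟨Metric.totallyBounded_iff.2 fun ε hε => ?_, (hcl ρ).isComplete⟩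
    obtain ⟨r, ⟨hrS, hrI⟩, hr⟩ := Metric.mem_closure_iff.1 hρ (ε / 2) (half_pos hε)
    rcases le_total ρ r with h | h
    · exact Metric.totallyBounded_iff.1 (hdown r hrS ρ h).totallyBounded ε hε
    -- Points at radius up to `ρ` lie within `ε / 2` of the compact part at radius `r`, so an `ε /
    -- 2`-net of the latter is an `ε`-net.
    · obtain ⟨t, ht, hcov⟩ :=
        Metric.totallyBounded_iff.1 (show IsCompact _ from hrS).totallyBounded (ε / 2) (half_pos hε)
      refine ⟨t, ht, fun y hy => ?_⟩
      obtain ⟨z, hz, hyz⟩ := hstep r ρ hrI.1 h y hy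
      obtain ⟨c, hct, hc⟩ := mem_iUnion₂.1 (hcov hz)
      refine mem_iUnion₂.2 ⟨c, hct, ?_⟩
      rw [Metric.mem_ball] at hc ⊢
      rw [Real.dist_eq, abs_of_nonneg (sub_nonneg.2 h)] at hr
      linarith [dist_triangle y z c]
  have hopen : ∀ r ∈ S ∩ Ico 0 R, S ∈ 𝓝[>] r := by
    rintro r ⟨hrS, hr0, -⟩
    -- Local compactness provides a compact `δ`-thickening, which contains the part of `s` of radius
    -- at most `r + δ`.
    obtain ⟨δ, hδ, hK⟩ := (show IsCompact _ from hrS).exists_isCompact_cthickening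
    refine mem_of_superset (Ioc_mem_nhdsGT (show r < r + δ by linarith)) fun ρ hρ => ?_
    refine hK.of_isClosed_subset (hcl ρ) fun y hy => ?_
    obtain ⟨z, hz, hyz⟩ := hstep r ρ hr0 hρ.1.le y hy
    exact Metric.mem_cthickening_of_dist_le y z δ _ hz (by linarith [hρ.2])
  exact hclosed.Icc_subset_of_forall_mem_nhdsWithin h0 hopen ⟨hR, le_rfl⟩

section MinimizingGeodesic

variable {M : Type*} [MetricSpace M] [ChartedSpace (EuclideanSpace ℝ (Fin 2)) M]
  [RiemannianBundle (fun x : M => TangentSpace (𝓡 2) x)]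

/-- The unit speed arc has length `b - a`. Integrating over the open interval avoids the end points,
where the speed is not prescribed. -/
theorem IsMinimizingGeodesic.dist_le [IsRiemannianManifold (𝓡 2) M] {γ : ℝ → M} {x y : M}
    (hγ : IsMinimizingGeodesic γ x y) {a b : ℝ} (ha : 0 ≤ a) (hab : a ≤ b) (hb : b ≤ dist x y) :
    dist (γ a) (γ b) ≤ b - a := by
  have h1 : ContMDiffOn 𝓘(ℝ, ℝ) (𝓡 2) 1 γ (Icc a b) :=
    (hγ.smooth.mono (Icc_subset_Icc ha hb)).of_le (by norm_cast)
  have h2 := Manifold.riemannianEDist_le_pathELength h1 rfl rfl hab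
  rw [← IsRiemannianManifold.out (I := 𝓡 2) (γ a) (γ b),
    Manifold.pathELength_eq_lintegral_mfderiv_Ioo,
    MeasureTheory.setLIntegral_congr_fun (g := fun _ => 1) measurableSet_Ioo (fun t ht => ?_),
    MeasureTheory.setLIntegral_one, Real.volume_Ioo, edist_dist] at h2
  · exact (ENNReal.ofReal_le_ofReal_iff (sub_nonneg.2 hab)).1 h2
  · rw [← ofReal_norm, hγ.unit_speed t ⟨ha.trans_lt ht.1, ht.2.trans_le hb⟩,
      ENNReal.ofReal_one]

/-- The upper bounds for the two pieces of `γ` add up to `dist x y`, so the triangle inequality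
makes the first one sharp. -/
theorem IsMinimizingGeodesic.dist_source [IsRiemannianManifold (𝓡 2) M] {γ : ℝ → M} {x y : M}
    (hγ : IsMinimizingGeodesic γ x y) {r : ℝ} (hr : r ∈ Icc 0 (dist x y)) :
    dist x (γ r) = r := by
  have h1 := hγ.dist_le le_rfl hr.1 hr.2
  have h2 := hγ.dist_le hr.1 hr.2 le_rfl
  rw [hγ.source] at h1
  rw [hγ.target] at h2
  linarith [dist_triangle x (γ r) y]

/-- Along a minimizing geodesic inside `Ω`, a spacelike function changes at speed less than one. -/
theorem IsMinimizingGeodesic.exists_hasDerivAt {Ω : Set M} {u : M → ℝ}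
    (hu : IsSpacelikeGraph Ω u) {γ : ℝ → M} {x y : M} (hγ : IsMinimizingGeodesic γ x y)
    (hΩ : MapsTo γ (Icc 0 (dist x y)) Ω) {t : ℝ} (ht : t ∈ Ioo 0 (dist x y)) :
    ∃ c : ℝ, HasDerivAt (u ∘ γ) c t ∧ |c| < 1 := by
  have htI := Ioo_subset_Icc_self ht
  have hnhds : Icc 0 (dist x y) ∈ 𝓝 t := Icc_mem_nhds ht.1 ht.2
  obtain ⟨du, hdu, hpos⟩ := hu.spacelike (γ t) (hΩ htI)
  have hγt : HasMFDerivAt 𝓘(ℝ, ℝ) (𝓡 2) γ t (mfderiv 𝓘(ℝ, ℝ) (𝓡 2) γ t) :=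
    ((hγ.smooth.contMDiffAt hnhds).mdifferentiableAt (by simp)).hasMFDerivAt
  have hcomp := (hdu.comp t hγt.hasMFDerivWithinAt hΩ).hasMFDerivAt hnhds
  have hderiv : HasDerivAt (u ∘ γ) (du (mfderiv 𝓘(ℝ, ℝ) (𝓡 2) γ t 1)) t :=
    hasDerivAt_iff_hasFDerivAt.2 <|
      (hasMFDerivAt_iff_hasFDerivAt.1 hcomp).congr_fderiv (by
        refine ContinuousLinearMap.ext_ring ?_
        exact (one_smul ℝ (du (mfderiv 𝓘(ℝ, ℝ) (𝓡 2) γ t 1) : ℝ)).symm)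
  refine ⟨_, hderiv, ?_⟩
  have hnorm := hγ.unit_speed t ht
  set v := mfderiv 𝓘(ℝ, ℝ) (𝓡 2) γ t 1
  have hv : v ≠ 0 := fun h => by simp [h] at hnorm
  -- For the unit vector `v`, positivity of the form reads `0 < 1 - (du v)²`.
  have h := hpos v hv
  rw [lorentzForm, real_inner_self_eq_norm_sq, hnorm, one_pow, sub_pos] at h
  exact (sq_lt_one_iff_abs_lt_one _).1 h

/-- Along a minimizing geodesic inside `Ω`, both `r - h` and `r + h` are strictly increasing. -/
theorem IsMinimizingGeodesic.strictMonoOn {Ω : Set M} {u : M → ℝ}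
    (hu : IsSpacelikeGraph Ω u) {γ : ℝ → M} {x y : M} (hγ : IsMinimizingGeodesic γ x y)
    (hΩ : MapsTo γ (Icc 0 (dist x y)) Ω) :
    StrictMonoOn (fun t => t - u (γ t)) (Icc 0 (dist x y)) ∧
      StrictMonoOn (fun t => t + u (γ t)) (Icc 0 (dist x y)) := by
  have hc : ContinuousOn (fun t => u (γ t)) (Icc 0 (dist x y)) :=
    hu.smooth.continuousOn.comp hγ.smooth.continuousOn hΩ
  constructor
  · refine strictMonoOn_of_deriv_pos (convex_Icc _ _) (continuousOn_id.sub hc) fun t ht => ?_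
    rw [interior_Icc] at ht
    obtain ⟨c, hd, hlt⟩ := hγ.exists_hasDerivAt hu hΩ ht
    have hd' : HasDerivAt (fun t => t - u (γ t)) (1 - c) t := (hasDerivAt_id t).sub hd
    rw [hd'.deriv]
    linarith [(abs_lt.1 hlt).2]
  · refine strictMonoOn_of_deriv_pos (convex_Icc _ _) (continuousOn_id.add hc) fun t ht => ?_
    rw [interior_Icc] at ht
    obtain ⟨c, hd, hlt⟩ := hγ.exists_hasDerivAt hu hΩ ht
    have hd' : HasDerivAt (fun t => t + u (γ t)) (1 + c) t := (hasDerivAt_id t).add hd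
    rw [hd'.deriv]
    linarith [(abs_lt.1 hlt).1]

theorem IsStarlike.abs_sub_lt {Ω : Set M} {x₀ : M} (hstar : IsStarlike Ω x₀) {u : M → ℝ}
    (hu : IsSpacelikeGraph Ω u) {x : M} (hx : x ∈ Ω) (hne : x ≠ x₀) :
    |u x - u x₀| < dist x₀ x := by
  obtain ⟨γ, hγ, hΩ⟩ := hstar.exists_geodesic x hx
  have hpos : 0 < dist x₀ x := dist_pos.2 hne.symm
  obtain ⟨h1, h2⟩ := hγ.strictMonoOn hu hΩ
  have h1 := h1 (left_mem_Icc.2 hpos.le) (right_mem_Icc.2 hpos.le) hpos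
  have h2 := h2 (left_mem_Icc.2 hpos.le) (right_mem_Icc.2 hpos.le) hpos
  simp only [hγ.source, hγ.target] at h1 h2
  rw [abs_lt]
  constructor <;> linarith

theorem IsStarlike.isCompact_inter_closedBall [IsRiemannianManifold (𝓡 2) M] [CompleteSpace M]
    {Ω : Set M} (hΩ : IsClosed Ω) {x₀ : M} (hstar : IsStarlike Ω x₀) (R : ℝ) :
    IsCompact (Ω ∩ Metric.closedBall x₀ R) := by
  have : LocallyCompactSpace M := ChartedSpace.locallyCompactSpace (EuclideanSpace ℝ (Fin 2)) M
  refine isCompact_inter_closedBall_of_segments hΩ (fun y hy r hr => ?_) R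
  obtain ⟨γ, hγ, hγΩ⟩ := hstar.exists_geodesic y hy
  refine ⟨γ r, hγΩ r hr, (hγ.dist_source hr).le, ?_⟩
  simpa only [hγ.target] using hγ.dist_le hr.1 hr.2 le_rfl

/-- Outside the unit ball, `r - |h|` is bounded below by a positive constant. -/
theorem IsStarlike.exists_pos_le_sub_abs [IsRiemannianManifold (𝓡 2) M] [CompleteSpace M]
    {Ω : Set M} (hΩ : IsClosed Ω) {x₀ : M} (hstar : IsStarlike Ω x₀) {u : M → ℝ}
    (hu : IsSpacelikeGraph Ω u) :
    ∃ η > 0, ∀ x ∈ Ω, 1 ≤ dist x₀ x → η ≤ dist x₀ x - |u x - u x₀| := by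
  have hK : IsCompact (Ω ∩ Metric.sphere x₀ 1) :=
    (hstar.isCompact_inter_closedBall hΩ 1).of_isClosed_subset (hΩ.inter Metric.isClosed_sphere)
      (inter_subset_inter_right _ Metric.sphere_subset_closedBall)
  have hcont : ContinuousOn (fun x => 1 - |u x - u x₀|) (Ω ∩ Metric.sphere x₀ 1) :=
    continuousOn_const.sub
      ((hu.smooth.continuousOn.mono inter_subset_left).sub continuousOn_const).abs
  have hpos : ∀ x ∈ Ω ∩ Metric.sphere x₀ 1, 0 < 1 - |u x - u x₀| := by
    rintro x ⟨hx, hd⟩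
    rw [Metric.mem_sphere, dist_comm] at hd
    have := hstar.abs_sub_lt hu hx (by rintro rfl; simp at hd)
    linarith
  obtain ⟨η, hη, hle⟩ := hK.exists_forall_le' hcont hpos
  refine ⟨η, hη, fun x hx hd => ?_⟩
  obtain ⟨γ, hγ, hγΩ⟩ := hstar.exists_geodesic x hx
  obtain ⟨h1, h2⟩ := hγ.strictMonoOn hu hγΩ
  have hmem : (1 : ℝ) ∈ Icc 0 (dist x₀ x) := ⟨zero_le_one, hd⟩
  have hend := right_mem_Icc.2 (zero_le_one.trans hd)
  have h1 := h1.monotoneOn hmem hend hd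
  have h2 := h2.monotoneOn hmem hend hd
  -- The geodesic to `x` crosses the unit sphere at `γ 1`; the bound there propagates outwards.
  have h3 := hle (γ 1) ⟨hγΩ 1 hmem, by rw [Metric.mem_sphere, dist_comm, hγ.dist_source hmem]⟩
  simp only [hγ.target] at h1 h2
  have h4 := neg_abs_le (u (γ 1) - u x₀)
  have h5 := le_abs_self (u (γ 1) - u x₀)
  rcases abs_cases (u x - u x₀) with ⟨h, -⟩ | ⟨h, -⟩ <;> rw [h] <;> linarith

/-- The sublevel sets of `r² - h²` on the graph are compact. -/
theorem IsStarlike.isCompact_lorentzPhi_le [IsRiemannianManifold (𝓡 2) M] [CompleteSpace M]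
    {Ω : Set M} (hΩ : IsClosed Ω) {x₀ : M} (hstar : IsStarlike Ω x₀) {u : M → ℝ}
    (hu : IsSpacelikeGraph Ω u) (c : ℝ) :
    IsCompact {p : graphSurface Ω u | lorentzPhi x₀ (u x₀) (p : M × ℝ) ≤ c} := by
  obtain ⟨η, hη, hle⟩ := hstar.exists_pos_le_sub_abs hΩ hu
  have hB := hstar.isCompact_inter_closedBall hΩ (max 1 (c / η))
  have hB' : IsCompact ((↑) ⁻¹' Metric.closedBall x₀ (max 1 (c / η)) : Set Ω) :=
    Topology.IsInducing.subtypeVal.isCompact_iff.2 (by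
      rwa [Subtype.image_preimage_coe])
  let g : Ω → graphSurface Ω u := fun x => ⟨(x, u x), x.2, rfl⟩
  have hg : Continuous g :=
    (continuous_subtype_val.prodMk
      (continuousOn_iff_continuous_domRestrict.1 hu.smooth.continuousOn)).subtype_mk _
  refine (hB'.image hg).of_isClosed_subset
    (isClosed_le (by unfold lorentzPhi; fun_prop) continuous_const) ?_
  rintro ⟨⟨x, t⟩, hx, ht⟩ hp
  obtain rfl : t = u x := ht
  refine ⟨⟨x, hx⟩, ?_, rfl⟩
  simp only [mem_ofPred_eq, lorentzPhi] at hp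
  rw [mem_preimage, Metric.mem_closedBall]
  rw [dist_comm] at hp ⊢
  rcases le_total (dist x₀ x) 1 with h | h
  · exact h.trans (le_max_left _ _)
  · refine le_max_of_le_right ((le_div_iff₀ hη).2 (le_trans ?_ hp))
    have h1 := hle x hx h
    rw [← sq_abs (u x - u x₀)]
    have h2 := abs_nonneg (u x - u x₀)
    -- The two products sum to `r (r - |h|) + |h| (r - |h|) = r² - h²`; the first is at least `η r`,
    -- the second nonnegative.
    nlinarith [mul_le_mul_of_nonneg_left h1 (show 0 ≤ dist x₀ x by linarith),
      mul_nonneg h2 (hη.le.trans h1)]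

end MinimizingGeodesic

theorem proposition4p1 {M : Type*} [MetricSpace M]
    [ChartedSpace (EuclideanSpace ℝ (Fin 2)) M] [IsManifold (𝓡 2) ∞ M]
    [RiemannianBundle (fun x : M => TangentSpace (𝓡 2) x)]
    [IsContMDiffRiemannianBundle (𝓡 2) ∞ (EuclideanSpace ℝ (Fin 2))
      (fun x : M => TangentSpace (𝓡 2) x)]
    [IsRiemannianManifold (𝓡 2) M] [CompleteSpace M]
    (Ω : Set M) (hΩ : IsClosed Ω) (x₀ : M) (hstar : IsStarlike Ω x₀)
    (u : M → ℝ) (hu : IsSpacelikeGraph Ω u) :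
    (∃ K : Set (graphSurface Ω u), IsCompact K ∧
      ∀ p : graphSurface Ω u, p ∉ K → 0 < lorentzPhi x₀ (u x₀) (p : M × ℝ)) ∧
    IsProperMap (fun p : graphSurface Ω u => lorentzPhi x₀ (u x₀) (p : M × ℝ)) := by

  have hcont : Continuous
      (fun p : graphSurface Ω u => lorentzPhi x₀ (u x₀) (p : M × ℝ)) := by
    unfold lorentzPhi
    fun_prop
  refine ⟨⟨_, hstar.isCompact_lorentzPhi_le hΩ hu 0, fun p hp => not_le.1 hp⟩,
    isProperMap_iff_isCompact_preimage.2 ⟨hcont, fun K hK => ?_⟩⟩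
  -- An upper bound alone suffices: the preimage of `K` is closed in a single compact sublevel set.
  obtain ⟨c, hc⟩ := hK.bddAbove
  exact (hstar.isCompact_lorentzPhi_le hΩ hu c).of_isClosed_subset
    (hK.isClosed.preimage hcont) fun p hp => hc hp
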